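/- Let $m,n\ge 0$ be integers and let $R=(R^{ij}_{kl})_{1\le i,j,k,l\le m}$ be a complex four-index tensor which is an $R$-matrix: viewed as the linear map $R(v_k\otimes v_l)=\sum_{i,j}R^{ij}_{kl}\,v_i\otimes v_j$ on $\mathbb{C}^m\otimes\mathbb{C}^m$, it satisfies $R^2=1$ and the Yang--Baxter equation $R_{12}R_{23}R_{12}=R_{23}R_{12}R_{23}$. Let $\mathcal{X}_R$ be the unital associative $\mathbb{C}$-algebra generated by $\psi^+_i,\psi^-_i$ ($1\le i\le m$) modulo the relations $$\psi^-_i\psi^+_j=\sum_{k,l}R^{ik}_{jl}\,\psi^+_k\psi^-_l+\delta_{ij},\qquad \psi^+_i\psi^+_j=\sum_{k,l}R^{kl}_{ij}\,\psi^+_k\psi^+_l,\qquad \psi^-_i\psi^-_j=\sum_{k,l}R^{ji}_{lk}\,\psi^-_k\psi^-_l .$$ Let $|0\rangle$ be the class of $1$ in the left $\mathcal{X}_R$-module $\mathcal{X}_R/\sum_i\mathcal{X}_R\psi^-_i$, and let $\mathfrak{V}_n=\mathrm{span}_{\mathbb{C}}\{\psi^+_{i_1}\cdots\psi^+_{i_n}|0\rangle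 : 1\le i_1,\dots,i_n\le m\}$. Let $\{\Psi^{(\alpha)}\}_{\alpha}$ be any basis of the space of all tensors $\Psi=(\Psi_{a_1\ldots a_n})\in(\mathbb{C}^m)^{\otimes n}$ such that $R_{j,j+1}\Psi=\Psi$ for all $1\le j\le n-1$, where $R_{j,j+1}$ denotes $R$ acting on the $j$-th and $(j+1)$-th tensor factors, i.e. $\Psi_{\ldots a_ja_{j+1}\ldots}=\sum_{k,l}R^{a_ja_{j+1}}_{kl}\Psi_{\ldots kl\ldots}$. Then the states $$|n,\alpha\rangle=\sum_{a_1,\dots,a_n}\Psi^{(\alpha)}_{a_1\ldots a_n}\,\psi^+_{a_1}\cdots\psi^+_{a_n}|0\rangle$$ are linearly independent and span $\mathfrak{V}_n$; that is, they form a basis of $\mathfrak{V}_n$. -/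

import Mathlib

namespace Paraparticle

/-- A four-index tensor `R^{ij}_{kl}`, stored as the matrix with row `(i, j)` and column `(k, l)`. -/
abbrev Tensor4 (m : ℕ) : Type := Matrix (Fin m × Fin m) (Fin m × Fin m) ℂ

/-- `R` is an `R`-matrix: `R² = 1` and `R` satisfies the (constant, braid form) Yang–Baxter equation
`R₁₂ R₂₃ R₁₂ = R₂₃ R₁₂ R₂₃`, written in components. -/
structure IsRMatrix {m : ℕ} (R : Tensor4 m) : Prop where
  mul_self : R * R = 1
  yangBaxter : ∀ i j k p q r : Fin m,
    (∑ x, ∑ y, ∑ z, R (i, j) (x, y) * R (y, k) (z, r) * R (x, z) (p, q)) =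
      ∑ x, ∑ y, ∑ z, R (j, k) (x, y) * R (i, x) (p, z) * R (z, y) (q, r)

/-- The free unital associative algebra on the symbols `ψ⁺_i` (`Sum.inl i`) and
`ψ⁻_i` (`Sum.inr i`). -/
abbrev FreeModes (m : ℕ) : Type := FreeAlgebra ℂ (Fin m ⊕ Fin m)

/-- The free symbol `ψ⁺_i`. -/
noncomputable def freePlus {m : ℕ} (i : Fin m) : FreeModes m := FreeAlgebra.ι ℂ (Sum.inl i)

/-- The free symbol `ψ⁻_i`. -/
noncomputable def freeMinus {m : ℕ} (i : Fin m) : FreeModes m := FreeAlgebra.ι ℂ (Sum.inr i)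

/-- The commutation relations of the single-mode algebra. -/
inductive Rel {m : ℕ} (R : Tensor4 m) : FreeModes m → FreeModes m → Prop
  | minus_plus (i j : Fin m) :
      Rel R (freeMinus i * freePlus j)
        ((∑ k, ∑ l, R (i, k) (j, l) • (freePlus k * freeMinus l)) + if i = j then 1 else 0)
  | plus_plus (i j : Fin m) :
      Rel R (freePlus i * freePlus j)
        (∑ k, ∑ l, R (k, l) (i, j) • (freePlus k * freePlus l))
  | minus_minus (i j : Fin m) :
      Rel R (freeMinus i * freeMinus j)
        (∑ k, ∑ l, R (j, i) (l, k) • (freeMinus k * freeMinus l))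

/-- The single-mode algebra `X_R`: generators `ψ⁺_i`, `ψ⁻_i` modulo the commutation relations. -/
abbrev XAlg {m : ℕ} (R : Tensor4 m) : Type := RingQuot (Rel R)

/-- The creation operator `ψ⁺_i` in `X_R`. -/
noncomputable def psiPlus {m : ℕ} (R : Tensor4 m) (i : Fin m) : XAlg R :=
  RingQuot.mkAlgHom ℂ (Rel R) (freePlus i)

/-- The annihilation operator `ψ⁻_i` in `X_R`. -/
noncomputable def psiMinus {m : ℕ} (R : Tensor4 m) (i : Fin m) : XAlg R :=
  RingQuot.mkAlgHom ℂ (Rel R) (freeMinus i)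

/-- The left ideal `∑ᵢ X_R ψ⁻_i`. -/
noncomputable def annihilatorIdeal {m : ℕ} (R : Tensor4 m) : Submodule (XAlg R) (XAlg R) :=
  Submodule.span (XAlg R) (Set.range (psiMinus R))

/-- The Fock module `X_R / ∑ᵢ X_R ψ⁻_i`, a left `X_R`-module. -/
abbrev Fock {m : ℕ} (R : Tensor4 m) : Type := XAlg R ⧸ annihilatorIdeal R

/-- The vacuum state `|0⟩`, the class of `1`. -/
noncomputable def vacuum {m : ℕ} (R : Tensor4 m) : Fock R :=
  Submodule.Quotient.mk (1 : XAlg R)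

/-- The state `ψ⁺_{a₁} ψ⁺_{a₂} ⋯ ψ⁺_{aₙ} |0⟩`. -/
noncomputable def monomialState {m n : ℕ} (R : Tensor4 m) (a : Fin n → Fin m) : Fock R :=
  (List.ofFn fun j => psiPlus R (a j)).prod • vacuum R

/-- The `n`-particle subspace `V_n` of the Fock module. -/
noncomputable def nParticle {m : ℕ} (R : Tensor4 m) (n : ℕ) : Submodule ℂ (Fock R) :=
  Submodule.span ℂ (Set.range (monomialState R : (Fin n → Fin m) → Fock R))

/-- Component tensors `Ψ_{a₁…aₙ}` of rank `n`. -/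
abbrev Tensors (m n : ℕ) : Type := (Fin n → Fin m) → ℂ

/-- The operator `R_{j,j+1}` on rank-`n` tensors:
`(R_{j,j+1} Ψ)_{…a_j a_{j+1}…} = ∑_{k,l} R^{a_j a_{j+1}}_{k l} Ψ_{…k l…}`
(positions are counted from `0`). -/
noncomputable def adjacentR {m n : ℕ} (R : Tensor4 m) (j : ℕ) (hj : j + 1 < n) :
    Tensors m n →ₗ[ℂ] Tensors m n where
  toFun Ψ a := ∑ k, ∑ l, R (a ⟨j, Nat.lt_of_succ_lt hj⟩, a ⟨j + 1, hj⟩) (k, l) *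
    Ψ (Function.update (Function.update a ⟨j, Nat.lt_of_succ_lt hj⟩ k) ⟨j + 1, hj⟩ l)
  map_add' Ψ Φ := by
    funext a
    simp only [Pi.add_apply, mul_add, Finset.sum_add_distrib]
  map_smul' c Ψ := by
    funext a
    simp only [Pi.smul_apply, smul_eq_mul, RingHom.id_apply, Finset.mul_sum]
    refine Finset.sum_congr rfl fun k _ => Finset.sum_congr rfl fun l _ => ?_
    ring

/-- The space of tensors `Ψ` with `R_{j,j+1} Ψ = Ψ` for all `j`. -/
noncomputable def invariantTensors {m : ℕ} (R : Tensor4 m) (n : ℕ) : Submodule ℂ (Tensors m n) :=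
  ⨅ (j : ℕ) (hj : j + 1 < n), LinearMap.eqLocus (adjacentR R j hj) LinearMap.id

/-- The state `∑_{a₁…aₙ} Ψ_{a₁…aₙ} ψ⁺_{a₁} ⋯ ψ⁺_{aₙ} |0⟩` of a tensor `Ψ`. -/
noncomputable def tensorState {m n : ℕ} (R : Tensor4 m) (Ψ : Tensors m n) : Fock R :=
  ∑ a, Ψ a • monomialState R a

end Paraparticle

/-! Let `T` send a tensor to its state. Pushing ψ⁻_c through the state of an invariant tensor of
rank n+1 gives n+1 times the state of its slice at first index c (`minus_tensorVector`). If the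
state vanishes, so do those of all slices; by induction on rank `T` is injective on invariant
tensors, provided |0⟩ ≠ 0.

For spanning, ∑ ψ⁺_c ψ⁻_c acts on the n-particle space as n (`sum_plus_minus`). Given v with n+1
particles, each ψ⁻_c v is by induction the state of an invariant tensor Φ_c; the tensor with slices
Φ_c/(n+1) has state v, and the ψ⁻ψ⁻ relation with injectivity makes it invariant.

The R-matrix hypotheses serve only to prove |0⟩ ≠ 0 (`vacuum_ne_zero`), by constructing a
representation of `XAlg R` with a nonzero vector killed by every ψ⁻_i. -/

namespace Paraparticle

/-! ### Compatibility of the mixed relation with the quadratic relations -/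

section QuadraticRelations

variable {m : ℕ} {R : Tensor4 m} {A : Type*} [Ring A] [Algebra ℂ A] {p a : Fin m → A}

/-- The mixed relation `a_i p_j = ∑ R^{ik}_{jl} p_k a_l + δ_ij` in an algebra. -/
def MixedRel (R : Tensor4 m) (p a : Fin m → A) : Prop :=
  ∀ i j, a i * p j = (∑ k, ∑ l, R (i, k) (j, l) • (p k * a l)) + if i = j then 1 else 0

/-- The defect of the quadratic relation between the `p`'s. -/
def plusDefect (R : Tensor4 m) (p : Fin m → A) (t : Fin m × Fin m) : A :=
  p t.1 * p t.2 - ∑ s, R s t • (p s.1 * p s.2)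

/-- The defect of the quadratic relation between the `a`'s. -/
def minusDefect (R : Tensor4 m) (a : Fin m → A) (t : Fin m × Fin m) : A :=
  a t.2 * a t.1 - ∑ s, R t s • (a s.2 * a s.1)

/-- The coefficients of `p_x p_y a_r` in the normal ordering of `a_c p_i p_j`. -/
def plusCoeff (R : Tensor4 m) (c : Fin m) (t s : Fin m × Fin m) (r : Fin m) : ℂ :=
  ∑ z, R (c, s.1) (t.1, z) * R (z, s.2) (t.2, r)

/-- The coefficients of `p_q a_r a_l` in the normal ordering of `a_i a_j p_c`. -/
def minusCoeff (R : Tensor4 m) (c : Fin m) (t : Fin m × Fin m) (q : Fin m)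
    (u : Fin m × Fin m) : ℂ :=
  ∑ z, R (t.1, z) (c, u.1) * R (t.2, q) (z, u.2)

/-- This is the Yang–Baxter equation: reordering two p's by `R` commutes with moving an annihilator
past both. -/
theorem IsRMatrix.sum_mul_plusCoeff (hR : IsRMatrix R) (c : Fin m) (t s : Fin m × Fin m)
    (r : Fin m) :
    ∑ u, R u t * plusCoeff R c u s r = ∑ u, R s u * plusCoeff R c t u r := by
  have h := hR.yangBaxter c s.1 s.2 t.1 t.2 r
  simp only [plusCoeff, Fintype.sum_prod_type, Finset.mul_sum]
  calc _ = ∑ x, ∑ y, ∑ z, R (c, s.1) (x, y) * R (y, s.2) (z, r) * R (x, z) (t.1, t.2) := by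
        refine Finset.sum_congr rfl fun x _ => ?_
        rw [Finset.sum_comm]
        refine Finset.sum_congr rfl fun y _ => Finset.sum_congr rfl fun z _ => ?_
        ring
    _ = _ := h.trans <| Finset.sum_congr rfl fun x _ => Finset.sum_congr rfl fun y _ =>
        Finset.sum_congr rfl fun z _ => by ring

theorem IsRMatrix.sum_mul_minusCoeff (hR : IsRMatrix R) (c : Fin m) (t : Fin m × Fin m)
    (q : Fin m) (u : Fin m × Fin m) :
    ∑ s, R t s * minusCoeff R c s q u = ∑ s, minusCoeff R c t q s * R s u := by
  have h := hR.yangBaxter t.1 t.2 q c u.1 u.2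
  simp only [minusCoeff, Fintype.sum_prod_type, Finset.mul_sum, Finset.sum_mul]
  calc _ = ∑ x, ∑ y, ∑ z, R (t.1, t.2) (x, y) * R (y, q) (z, u.2) * R (x, z) (c, u.1) := by
        refine Finset.sum_congr rfl fun x _ => Finset.sum_congr rfl fun y _ =>
          Finset.sum_congr rfl fun z _ => by ring
    _ = ∑ x, ∑ y, ∑ z, R (t.2, q) (x, y) * R (t.1, x) (c, z) * R (z, y) (u.1, u.2) := h
    _ = ∑ z, ∑ y, ∑ x, R (t.2, q) (x, y) * R (t.1, x) (c, z) * R (z, y) (u.1, u.2) := by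
        rw [Finset.sum_comm]
        refine (Finset.sum_congr rfl fun y _ => Finset.sum_comm).trans ?_
        rw [Finset.sum_comm]
    _ = _ := Finset.sum_congr rfl fun x _ => Finset.sum_congr rfl fun y _ =>
        Finset.sum_congr rfl fun z _ => by ring

theorem IsRMatrix.sum_mul (hR : IsRMatrix R) (s t : Fin m × Fin m) :
    ∑ u, R s u * R u t = if s = t then 1 else 0 := by
  simpa [Matrix.mul_apply, Matrix.one_apply] using congrFun (congrFun hR.mul_self s) t

theorem MixedRel.mul_plus_mul_plus (h : MixedRel R p a) (c : Fin m) (t : Fin m × Fin m) :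
    a c * (p t.1 * p t.2) =
      (∑ k, ((if (c, k) = t then 1 else 0) + R (c, k) t) • p k) +
        ∑ s, ∑ r, plusCoeff R c t s r • (p s.1 * p s.2 * a r) := by
  obtain ⟨i, j⟩ := t
  have h1 : a c * (p i * p j) = (∑ k, ∑ l, R (c, k) (i, l) • (p k * (a l * p j))) +
      (if c = i then p j else 0) := by
    rw [← mul_assoc, h, add_mul, Finset.sum_mul]
    simp only [Finset.sum_mul, smul_mul_assoc, mul_assoc, ite_mul, one_mul, zero_mul]
  have h2 : ∀ k l, p k * (a l * p j) = (∑ q, ∑ r, R (l, q) (j, r) • (p k * p q * a r)) +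
      (if l = j then p k else 0) := by
    intro k l
    rw [h, mul_add, Finset.mul_sum]
    simp only [Finset.mul_sum, mul_smul_comm, mul_assoc, mul_ite, mul_one, mul_zero]
  simp only [h1, h2, smul_add, Finset.sum_add_distrib, add_smul, smul_ite, smul_zero, ite_smul,
    one_smul, zero_smul, Finset.sum_ite_eq', Finset.mem_univ, if_true,
    Prod.mk.injEq, ite_and, plusCoeff, Finset.sum_smul, Finset.smul_sum, smul_smul,
    Fintype.sum_prod_type]
  have h3 : (∑ x, if c = i then if x = j then p x else 0 else 0) = if c = i then p j else 0 := by
    split_ifs <;> simp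
  have h4 : (∑ k, ∑ l, ∑ q, ∑ r, (R (c, k) (i, l) * R (l, q) (j, r)) • (p k * p q * a r)) =
      ∑ k, ∑ q, ∑ r, ∑ l, (R (c, k) (i, l) * R (l, q) (j, r)) • (p k * p q * a r) := by
    refine Finset.sum_congr rfl fun k _ => ?_
    rw [Finset.sum_comm]
    refine Finset.sum_congr rfl fun q _ => Finset.sum_comm
  rw [h3, h4]
  abel

theorem MixedRel.mul_minus_mul_minus (h : MixedRel R p a) (c : Fin m) (t : Fin m × Fin m) :
    a t.2 * a t.1 * p c =
      (∑ l, ((if t = (c, l) then 1 else 0) + R t (c, l)) • a l) +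
        ∑ q, ∑ u, minusCoeff R c t q u • (p q * (a u.2 * a u.1)) := by
  obtain ⟨j, i⟩ := t
  have h1 : a i * a j * p c = (∑ k, ∑ l, R (j, k) (c, l) • (a i * p k * a l)) +
      (if j = c then a i else 0) := by
    rw [mul_assoc, h, mul_add, Finset.mul_sum]
    simp only [Finset.mul_sum, mul_smul_comm, mul_assoc, mul_ite, mul_one, mul_zero]
  have h2 : ∀ k l, a i * p k * a l = (∑ q, ∑ r, R (i, q) (k, r) • (p q * (a r * a l))) +
      (if i = k then a l else 0) := by
    intro k l
    rw [h, add_mul, Finset.sum_mul]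
    simp only [Finset.sum_mul, smul_mul_assoc, mul_assoc, ite_mul, one_mul, zero_mul]
  simp only [h1, h2, smul_add, Finset.sum_add_distrib, add_smul, smul_ite, smul_zero, ite_smul,
    one_smul, zero_smul,
    Prod.mk.injEq, ite_and, minusCoeff, Finset.sum_smul, Finset.smul_sum, smul_smul,
    Fintype.sum_prod_type]
  have h3 : (∑ x, if j = c then if i = x then a x else 0 else 0) = if j = c then a i else 0 := by
    split_ifs <;> simp
  have h5 : (∑ k, ∑ l, if i = k then R (j, k) (c, l) • a l else 0) = ∑ l, R (j, i) (c, l) • a l := by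
    rw [Finset.sum_comm]
    simp
  have h4 : (∑ k, ∑ l, ∑ q, ∑ r, (R (j, k) (c, l) * R (i, q) (k, r)) • (p q * (a r * a l))) =
      ∑ q, ∑ l, ∑ r, ∑ k, (R (j, k) (c, l) * R (i, q) (k, r)) • (p q * (a r * a l)) := by
    calc _ = ∑ k, ∑ q, ∑ l, ∑ r, (R (j, k) (c, l) * R (i, q) (k, r)) • (p q * (a r * a l)) :=
          Finset.sum_congr rfl fun k _ => Finset.sum_comm
      _ = ∑ q, ∑ k, ∑ l, ∑ r, (R (j, k) (c, l) * R (i, q) (k, r)) • (p q * (a r * a l)) :=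
          Finset.sum_comm
      _ = _ := by
          refine Finset.sum_congr rfl fun q _ => ?_
          rw [Finset.sum_comm]
          exact Finset.sum_congr rfl fun l _ => Finset.sum_comm
  rw [h3, h4, h5]
  abel

/-- Normal ordering yields linear terms with coefficients 1 + R, which cancel in the defect because
R² = 1 gives (1 + R)R = 1 + R; the cubic terms regroup into defects by Yang–Baxter. Hence
annihilators move past defects with no remainder. -/
theorem MixedRel.mul_plusDefect (h : MixedRel R p a) (hR : IsRMatrix R) (c : Fin m)
    (t : Fin m × Fin m) :
    a c * plusDefect R p t = ∑ s, ∑ r, plusCoeff R c t s r • (plusDefect R p s * a r) := by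
  have hlin : (∑ s, R s t • ∑ k, ((if (c, k) = s then 1 else 0) + R (c, k) s) • p k) =
      ∑ k, ((if (c, k) = t then 1 else 0) + R (c, k) t) • p k := by
    simp only [Finset.smul_sum, smul_smul]
    rw [Finset.sum_comm]
    refine Finset.sum_congr rfl fun k _ => ?_
    rw [← Finset.sum_smul]
    congr 1
    simp only [mul_add, Finset.sum_add_distrib, mul_ite, mul_one, mul_zero, Finset.sum_ite_eq,
      Finset.mem_univ, if_true]
    rw [← hR.sum_mul (c, k) t, add_comm]
    exact congrArg (· + _) (Finset.sum_congr rfl fun s _ => mul_comm _ _)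
  have hquad : (∑ u, R u t • ∑ s, ∑ r, plusCoeff R c u s r • (p s.1 * p s.2 * a r)) =
      ∑ s, ∑ r, plusCoeff R c t s r • ((∑ u, R u s • (p u.1 * p u.2)) * a r) := by
    simp only [Finset.smul_sum, smul_smul, Finset.sum_mul, smul_mul_assoc]
    calc _ = ∑ s, ∑ r, ∑ u, (R u t * plusCoeff R c u s r) • (p s.1 * p s.2 * a r) := by
          rw [Finset.sum_comm]
          exact Finset.sum_congr rfl fun s _ => Finset.sum_comm
      _ = ∑ s, ∑ r, ∑ u, (R s u * plusCoeff R c t u r) • (p s.1 * p s.2 * a r) := by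
          simp only [← Finset.sum_smul, hR.sum_mul_plusCoeff]
      _ = ∑ u, ∑ r, ∑ s, (R s u * plusCoeff R c t u r) • (p s.1 * p s.2 * a r) := by
          calc _ = ∑ s, ∑ u, ∑ r, (R s u * plusCoeff R c t u r) • (p s.1 * p s.2 * a r) :=
                Finset.sum_congr rfl fun s _ => Finset.sum_comm
            _ = _ := by
                rw [Finset.sum_comm]
                exact Finset.sum_congr rfl fun s _ => Finset.sum_comm
      _ = _ := by simp only [mul_comm]
  rw [plusDefect, mul_sub, Finset.mul_sum]
  simp only [mul_smul_comm, h.mul_plus_mul_plus]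
  simp only [smul_add, Finset.sum_add_distrib]
  rw [hlin, hquad, add_sub_add_left_eq_sub]
  simp only [plusDefect, sub_mul, smul_sub, Finset.sum_sub_distrib]

/-- Mirror image of `mul_plusDefect`: the linear terms cancel by R(1 + R) = 1 + R. It makes the
common kernel of the defects stable under creation. -/
theorem MixedRel.minusDefect_mul (h : MixedRel R p a) (hR : IsRMatrix R) (c : Fin m)
    (t : Fin m × Fin m) :
    minusDefect R a t * p c = ∑ q, ∑ u, minusCoeff R c t q u • (p q * minusDefect R a u) := by
  have hlin : (∑ s, R t s • ∑ l, ((if s = (c, l) then 1 else 0) + R s (c, l)) • a l) =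
      ∑ l, ((if t = (c, l) then 1 else 0) + R t (c, l)) • a l := by
    simp only [Finset.smul_sum, smul_smul]
    rw [Finset.sum_comm]
    refine Finset.sum_congr rfl fun k _ => ?_
    rw [← Finset.sum_smul]
    congr 1
    simp only [mul_add, Finset.sum_add_distrib, mul_ite, mul_one, mul_zero, Finset.sum_ite_eq',
      Finset.mem_univ, if_true]
    rw [← hR.sum_mul t (c, k), add_comm]
  have hquad : (∑ s, R t s • ∑ q, ∑ u, minusCoeff R c s q u • (p q * (a u.2 * a u.1))) =
      ∑ q, ∑ s, minusCoeff R c t q s • (p q * ∑ u, R s u • (a u.2 * a u.1)) := by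
    simp only [Finset.smul_sum, smul_smul, Finset.mul_sum, mul_smul_comm]
    rw [Finset.sum_comm]
    refine Finset.sum_congr rfl fun q _ => ?_
    rw [Finset.sum_comm, Finset.sum_comm (f := fun s u => (minusCoeff R c t q s * R s u) • _)]
    simp only [← Finset.sum_smul, hR.sum_mul_minusCoeff]
  rw [minusDefect, sub_mul, Finset.sum_mul]
  simp only [smul_mul_assoc, h.mul_minus_mul_minus]
  simp only [smul_add, Finset.sum_add_distrib]
  rw [hlin, hquad, add_sub_add_left_eq_sub]
  simp only [minusDefect, mul_sub, smul_sub, Finset.sum_sub_distrib]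

end QuadraticRelations

/-! ### A model representation on functions on words, and nonvanishing of the vacuum -/

section FockRepresentation

variable {m : ℕ}

/-- Annihilation on functions on words: restriction to the words beginning with `i`. -/
def wordMinus (i : Fin m) : Module.End ℂ (List (Fin m) → ℂ) :=
  LinearMap.funLeft ℂ ℂ (List.cons i)

/-- The value at a word of the creation operator on functions on words, defined by recursion on
the word in the unique way compatible with the mixed relation. -/
noncomputable def wordPlusAt (R : Tensor4 m) :
    List (Fin m) → Fin m → ((List (Fin m) → ℂ) →ₗ[ℂ] ℂ)
  | [], _ => 0
  | c :: w, j => (∑ k, ∑ l, R (c, k) (j, l) • (wordPlusAt R w k ∘ₗ wordMinus l)) +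
      if c = j then LinearMap.proj w else 0

/-- Creation on functions on words. -/
noncomputable def wordPlus (R : Tensor4 m) (j : Fin m) : Module.End ℂ (List (Fin m) → ℂ) :=
  LinearMap.pi fun w => wordPlusAt R w j

@[simp]
theorem wordMinus_apply (i : Fin m) (f : List (Fin m) → ℂ) (w : List (Fin m)) :
    wordMinus i f w = f (i :: w) := rfl

@[simp]
theorem wordPlus_apply_nil (R : Tensor4 m) (j : Fin m) (f : List (Fin m) → ℂ) :
    wordPlus R j f [] = 0 := by
  simp [wordPlus, wordPlusAt]

theorem mixedRel_word (R : Tensor4 m) : MixedRel R (wordPlus R) wordMinus := by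
  intro i j
  refine LinearMap.ext fun f => funext fun w => ?_
  simp only [Module.End.mul_apply, wordMinus_apply, LinearMap.add_apply, LinearMap.sum_apply,
    LinearMap.smul_apply, Pi.add_apply, Finset.sum_apply, Pi.smul_apply]
  simp only [wordPlus, LinearMap.pi_apply, wordPlusAt, LinearMap.add_apply, LinearMap.sum_apply,
    LinearMap.smul_apply, LinearMap.comp_apply]
  split_ifs <;> simp

/-- Evaluating at `c :: w` is applying a_c and evaluating at `w`; `mul_plusDefect` then leaves only
defects at the shorter word `w`, so induction on the word applies. At the empty word creation gives
0. -/
theorem plusDefect_word {R : Tensor4 m} (hR : IsRMatrix R) (t : Fin m × Fin m) :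
    plusDefect R (wordPlus R) t = 0 := by
  suffices h : ∀ (w : List (Fin m)) (t : Fin m × Fin m) (f : List (Fin m) → ℂ),
      plusDefect R (wordPlus R) t f w = 0 from
    LinearMap.ext fun f => funext fun w => h w t f
  intro w
  induction w with
  | nil => intro t f; simp [plusDefect]
  | cons c w ih =>
    intro t f
    have h := congrFun (LinearMap.congr_fun ((mixedRel_word R).mul_plusDefect hR c t) f) w
    simpa [ih] using h

/-- The functions on words on which the annihilation operators satisfy their quadratic relations,
also after stripping any prefix. -/
def symmetricFunctions (R : Tensor4 m) : Submodule ℂ (List (Fin m) → ℂ) where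
  carrier := {f | ∀ (v : List (Fin m)) (t : Fin m × Fin m),
    minusDefect R wordMinus t (fun u => f (v ++ u)) = 0}
  zero_mem' v t := map_zero _
  add_mem' {f g} hf hg v t :=
    (map_add (minusDefect R wordMinus t) (fun u => f (v ++ u)) (fun u => g (v ++ u))).trans
      (by rw [hf v t, hg v t, add_zero])
  smul_mem' c f hf v t :=
    (map_smul (minusDefect R wordMinus t) c (fun u => f (v ++ u))).trans
      (by rw [hf v t, smul_zero])

theorem wordMinus_mem {R : Tensor4 m} (i : Fin m) {f : List (Fin m) → ℂ}
    (hf : f ∈ symmetricFunctions R) : wordMinus i f ∈ symmetricFunctions R :=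
  fun v t => hf (i :: v) t

theorem minusDefect_apply_eq_zero {R : Tensor4 m} {f : List (Fin m) → ℂ}
    (hf : f ∈ symmetricFunctions R) (t : Fin m × Fin m) : minusDefect R wordMinus t f = 0 :=
  hf [] t

theorem wordPlus_mem {R : Tensor4 m} (hR : IsRMatrix R) (j : Fin m) {f : List (Fin m) → ℂ}
    (hf : f ∈ symmetricFunctions R) : wordPlus R j f ∈ symmetricFunctions R := by
  intro v
  induction v generalizing j f with
  | nil =>
    intro t
    have h := LinearMap.congr_fun ((mixedRel_word R).minusDefect_mul hR j t) f
    simpa [minusDefect_apply_eq_zero hf] using h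
  | cons c v ih =>
    intro t
    have h := LinearMap.congr_fun (mixedRel_word R c j) f
    -- Stripping `c` with the mixed relation leaves functions p_k (a_l f), covered by induction on
    -- the prefix, and possibly `f` itself.
    have h' : (fun u => wordPlus R j f (c :: v ++ u)) =
        (∑ k, ∑ l, R (c, k) (j, l) • fun u => wordPlus R k (wordMinus l f) (v ++ u)) +
          if c = j then fun u => f (v ++ u) else 0 := by
      funext u
      have := congrFun h (v ++ u)
      simp only [Module.End.mul_apply, wordMinus_apply, LinearMap.add_apply, LinearMap.sum_apply,
        LinearMap.smul_apply, Pi.add_apply, Finset.sum_apply, Pi.smul_apply] at this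
      simp only [List.cons_append, this, Pi.add_apply, Finset.sum_apply, Pi.smul_apply]
      split_ifs <;> simp
    rw [h', map_add, map_sum]
    simp only [map_sum, map_smul, ih _ (wordMinus_mem _ hf), smul_zero, Finset.sum_const_zero,
      zero_add]
    split_ifs
    · exact hf v t
    · exact map_zero _

/-- The indicator function of the empty word. -/
def emptyWord (m : ℕ) : List (Fin m) → ℂ := Pi.single [] 1

theorem wordMinus_emptyWord (i : Fin m) : wordMinus i (emptyWord m) = 0 := by
  funext w
  simp [emptyWord]

theorem emptyWord_mem (R : Tensor4 m) : emptyWord m ∈ symmetricFunctions R := by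
  intro v t
  cases v with
  | nil => simp [minusDefect, wordMinus_emptyWord, Module.End.mul_apply]
  | cons c v =>
    have : (fun u => emptyWord m (c :: v ++ u)) = 0 := by
      funext u
      simp [emptyWord]
    rw [this, map_zero]

/-- The action of the free generators on symmetric functions on words. -/
noncomputable def generatorAction {R : Tensor4 m} (hR : IsRMatrix R) :
    Fin m ⊕ Fin m → Module.End ℂ (symmetricFunctions R)
  | .inl j => (wordPlus R j).restrict fun _ => wordPlus_mem hR j
  | .inr i => (wordMinus i).restrict fun _ => wordMinus_mem i

/-- The representation of `X_R` on symmetric functions on words. -/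
noncomputable def wordRepresentation {R : Tensor4 m} (hR : IsRMatrix R) :
    XAlg R →ₐ[ℂ] Module.End ℂ (symmetricFunctions R) :=
  RingQuot.liftAlgHom ℂ ⟨FreeAlgebra.lift ℂ (generatorAction hR), by
    intro x y h
    refine LinearMap.ext fun f => Subtype.ext ?_
    cases h with
    | minus_plus i j =>
      have h := LinearMap.congr_fun (mixedRel_word R i j) f.1
      simp only [freeMinus, freePlus, map_mul, map_add, map_sum, map_smul, FreeAlgebra.lift_ι_apply,
        generatorAction]
      simp only [Module.End.mul_apply, LinearMap.add_apply, LinearMap.sum_apply,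
        LinearMap.smul_apply, Submodule.coe_add, Submodule.coe_sum, Submodule.coe_smul,
        LinearMap.coe_restrict_apply] at h ⊢
      rw [h]
      split_ifs <;> simp
    | plus_plus i j =>
      have h := LinearMap.congr_fun (sub_eq_zero.1 (plusDefect_word hR (i, j))) f.1
      simpa [freePlus, generatorAction, Fintype.sum_prod_type] using h
    | minus_minus i j =>
      -- The pair is reversed because the defect at `t` starts with a_{t.2} a_{t.1}.
      have h := minusDefect_apply_eq_zero f.2 (j, i)
      rw [minusDefect, LinearMap.sub_apply, sub_eq_zero] at h
      rw [Fintype.sum_prod_type, Finset.sum_comm] at h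
      simpa [freeMinus, generatorAction] using h⟩

theorem wordRepresentation_psiMinus {R : Tensor4 m} (hR : IsRMatrix R) (i : Fin m)
    (f : symmetricFunctions R) :
    (wordRepresentation hR (psiMinus R i) f : List (Fin m) → ℂ) = wordMinus i f := by
  simp [wordRepresentation, psiMinus, freeMinus, generatorAction]

/-- If the vacuum vanished, 1 would lie in the left ideal of the ψ⁻_i, all of which kills the
empty-word function in the model; but 1 fixes it. -/
theorem vacuum_ne_zero {R : Tensor4 m} (hR : IsRMatrix R) : vacuum R ≠ 0 := by
  intro h
  have hmem : (1 : XAlg R) ∈ annihilatorIdeal R := (Submodule.Quotient.mk_eq_zero _).1 h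
  have key : ∀ x ∈ annihilatorIdeal R,
      wordRepresentation hR x ⟨emptyWord m, emptyWord_mem R⟩ = 0 := by
    intro x hx
    induction hx using Submodule.span_induction with
    | mem x hx =>
      obtain ⟨i, rfl⟩ := hx
      refine Subtype.ext ?_
      rw [wordRepresentation_psiMinus]
      exact wordMinus_emptyWord i
    | zero => simp
    | add x y _ _ hx hy => simp [hx, hy]
    | smul r x _ hx => simp [hx, Module.End.mul_apply]
  have h1 := congrArg Subtype.val (key 1 hmem)
  simpa [emptyWord] using congrFun h1 []

end FockRepresentation

/-! ### Slicing invariant tensors -/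

section InvariantTensors

variable {m : ℕ}

/-- Fixing the first index of a tensor, as an operation lowering the rank. -/
def Tensors.slice {n : ℕ} (c : Fin m) (Ψ : Tensors m (n + 1)) : Tensors m n :=
  fun a => Ψ (Fin.cons c a)

theorem Tensors.ext_slice {n : ℕ} {Ψ Φ : Tensors m (n + 1)}
    (h : ∀ c, Tensors.slice c Ψ = Tensors.slice c Φ) : Ψ = Φ := by
  funext a
  rw [← Fin.cons_self_tail a]
  exact congrFun (h (a 0)) (Fin.tail a)

theorem mem_invariantTensors {R : Tensor4 m} {n : ℕ} {Ψ : Tensors m n} :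
    Ψ ∈ invariantTensors R n ↔ ∀ (j : ℕ) (hj : j + 1 < n), adjacentR R j hj Ψ = Ψ := by
  simp [invariantTensors]

theorem mem_invariantTensors_of_lt_two {R : Tensor4 m} {n : ℕ} (hn : n < 2) (Ψ : Tensors m n) :
    Ψ ∈ invariantTensors R n :=
  mem_invariantTensors.2 fun j hj => by omega

theorem slice_slice_adjacentR_zero (R : Tensor4 m) {n : ℕ} (Ψ : Tensors m (n + 2)) (c k : Fin m) :
    Tensors.slice k (Tensors.slice c (adjacentR R 0 (by omega) Ψ)) =
      ∑ i, ∑ l, R (c, k) (i, l) • Tensors.slice l (Tensors.slice i Ψ) := by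
  funext a
  have h (i l : Fin m) : Function.update (Function.update
      (Fin.cons c (Fin.cons k a : Fin (n + 1) → Fin m) : Fin (n + 2) → Fin m) 0 i) 1 l =
        Fin.cons i (Fin.cons l a : Fin (n + 1) → Fin m) := by
    rw [Fin.update_cons_zero, ← Fin.succ_zero_eq_one, ← Fin.cons_update, Fin.update_cons_zero]
  change ∑ i, ∑ l, R (c, k) (i, l) * Ψ (Function.update (Function.update
    (Fin.cons c (Fin.cons k a : Fin (n + 1) → Fin m) : Fin (n + 2) → Fin m) 0 i) 1 l) = _
  simp only [h, Finset.sum_apply, Pi.smul_apply, smul_eq_mul, Tensors.slice]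

theorem slice_adjacentR_succ (R : Tensor4 m) {n : ℕ} (Ψ : Tensors m (n + 1)) (c : Fin m) (j : ℕ)
    (hj : j + 1 < n) :
    Tensors.slice c (adjacentR R (j + 1) (Nat.succ_lt_succ hj) Ψ) =
      adjacentR R j hj (Tensors.slice c Ψ) := by
  funext a
  simp only [Tensors.slice, adjacentR, LinearMap.coe_mk, AddHom.coe_mk, Fin.cons_update]
  rfl

/-- The later adjacent operators act inside each slice, so only the first pair of indices gives a
new condition. This drives the inductions on rank. -/
theorem mem_invariantTensors_succ_succ {R : Tensor4 m} {n : ℕ} {Ψ : Tensors m (n + 2)} :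
    Ψ ∈ invariantTensors R (n + 2) ↔
      (∀ c k, ∑ i, ∑ l, R (c, k) (i, l) • Tensors.slice l (Tensors.slice i Ψ) =
        Tensors.slice k (Tensors.slice c Ψ)) ∧
      ∀ c, Tensors.slice c Ψ ∈ invariantTensors R (n + 1) := by
  simp only [mem_invariantTensors, ← slice_slice_adjacentR_zero]
  constructor
  · intro h
    refine ⟨fun c k => by rw [h], fun c j hj => ?_⟩
    rw [← slice_adjacentR_succ, h]
  · rintro ⟨h0, h⟩ (_ | j) hj
    · exact Tensors.ext_slice fun c => Tensors.ext_slice fun k => h0 c k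
    · exact Tensors.ext_slice fun c =>
        (slice_adjacentR_succ R Ψ c j (Nat.lt_of_succ_lt_succ hj)).trans (h c j _)

theorem slice_mem_invariantTensors {R : Tensor4 m} {n : ℕ} {Ψ : Tensors m (n + 1)}
    (h : Ψ ∈ invariantTensors R (n + 1)) (c : Fin m) :
    Tensors.slice c Ψ ∈ invariantTensors R n := by
  cases n with
  | zero => exact mem_invariantTensors_of_lt_two (by omega) _
  | succ n => exact (mem_invariantTensors_succ_succ.1 h).2 c

end InvariantTensors

/-! ### States of tensors in an abstract Fock system -/

section States

variable {m : ℕ} {R : Tensor4 m} {V : Type*} [AddCommGroup V] [Module ℂ V]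
  {p a : Fin m → Module.End ℂ V} {v₀ : V}

/-- Operators `p_i`, `a_i` on a vector space satisfying the relations of `X_R`, together with a
vector annihilated by every `a_i`. -/
structure IsFockSystem (R : Tensor4 m) (p a : Fin m → Module.End ℂ V) (v₀ : V) : Prop where
  minus_plus (i j : Fin m) (v : V) :
    a i (p j v) = (∑ k, ∑ l, R (i, k) (j, l) • p k (a l v)) + if i = j then v else 0
  plus_plus (i j : Fin m) (v : V) : p i (p j v) = ∑ k, ∑ l, R (k, l) (i, j) • p k (p l v)
  minus_minus (i j : Fin m) (v : V) : a i (a j v) = ∑ k, ∑ l, R (j, i) (l, k) • a k (a l v)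
  minus_vacuum (i : Fin m) : a i v₀ = 0

/-- The vector `p_{w₁} ⋯ p_{wₙ} v₀`. -/
def monomialVector (p : Fin m → Module.End ℂ V) (v₀ : V) {n : ℕ} (w : Fin n → Fin m) : V :=
  (List.ofFn fun j => p (w j)).prod v₀

/-- The map `Ψ ↦ ∑ Ψ_{w₁…wₙ} p_{w₁} ⋯ p_{wₙ} v₀`. -/
noncomputable def tensorVector (p : Fin m → Module.End ℂ V) (v₀ : V) (n : ℕ) :
    Tensors m n →ₗ[ℂ] V :=
  Fintype.linearCombination ℂ (monomialVector p v₀)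

theorem tensorVector_apply {n : ℕ} (Ψ : Tensors m n) :
    tensorVector p v₀ n Ψ = ∑ w, Ψ w • monomialVector p v₀ w := rfl

theorem monomialVector_zero (w : Fin 0 → Fin m) : monomialVector p v₀ w = v₀ := by
  simp [monomialVector]

theorem monomialVector_cons {n : ℕ} (i : Fin m) (w : Fin n → Fin m) :
    monomialVector p v₀ (Fin.cons i w : Fin (n + 1) → Fin m) = p i (monomialVector p v₀ w) := by
  simp [monomialVector, List.ofFn_succ]

theorem tensorVector_zero (Ψ : Tensors m 0) : tensorVector p v₀ 0 Ψ = Ψ default • v₀ := by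
  simp [tensorVector_apply, monomialVector_zero]

theorem tensorVector_succ {n : ℕ} (Ψ : Tensors m (n + 1)) :
    tensorVector p v₀ (n + 1) Ψ = ∑ c, p c (tensorVector p v₀ n (Tensors.slice c Ψ)) := by
  simp only [tensorVector_apply]
  rw [← (Fin.consEquiv fun _ => Fin m).sum_comp, Fintype.sum_prod_type]
  refine Finset.sum_congr rfl fun c _ => ?_
  rw [map_sum]
  refine Finset.sum_congr rfl fun w _ => ?_
  rw [map_smul, ← monomialVector_cons]
  rfl

theorem monomialVector_mem_range {n : ℕ} (w : Fin n → Fin m) :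
    monomialVector p v₀ w ∈ LinearMap.range (tensorVector p v₀ n) := by
  rw [tensorVector, Fintype.range_linearCombination]
  exact Submodule.subset_span ⟨w, rfl⟩

theorem plus_mem_range {n : ℕ} (i : Fin m) {v : V}
    (hv : v ∈ LinearMap.range (tensorVector p v₀ n)) :
    p i v ∈ LinearMap.range (tensorVector p v₀ (n + 1)) := by
  obtain ⟨Ψ, rfl⟩ := hv
  rw [tensorVector_apply, map_sum]
  refine sum_mem fun w _ => ?_
  rw [map_smul, ← monomialVector_cons]
  exact Submodule.smul_mem _ _ (monomialVector_mem_range _)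

namespace IsFockSystem

theorem minus_tensorVector (H : IsFockSystem R p a v₀) {n : ℕ} {Ψ : Tensors m (n + 1)}
    (h : Ψ ∈ invariantTensors R (n + 1)) (c : Fin m) :
    a c (tensorVector p v₀ (n + 1) Ψ) =
      ((n : ℂ) + 1) • tensorVector p v₀ n (Tensors.slice c Ψ) := by
  induction n generalizing c with
  | zero =>
    simp [tensorVector_succ, tensorVector_zero, H.minus_plus, H.minus_vacuum]
  | succ n ih =>
    obtain ⟨h0, hs⟩ := mem_invariantTensors_succ_succ.1 h
    -- By induction a_l turns the slice at j into its double slice; invariance in the first two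
    -- indices then absorbs `R`. The Kronecker delta supplies the one further copy of the slice.
    have key : ∑ j, ∑ k, ∑ l, R (c, k) (j, l) •
        p k (a l (tensorVector p v₀ (n + 1) (Tensors.slice j Ψ))) =
        ((n : ℂ) + 1) • tensorVector p v₀ (n + 1) (Tensors.slice c Ψ) := by
      rw [Finset.sum_comm, tensorVector_succ, Finset.smul_sum]
      refine Finset.sum_congr rfl fun k _ => ?_
      rw [← h0 c k]
      simp only [map_sum, map_smul, Finset.smul_sum]
      refine Finset.sum_congr rfl fun j _ => Finset.sum_congr rfl fun l _ => ?_
      rw [ih (hs j) l, map_smul, smul_comm]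
    rw [tensorVector_succ, map_sum]
    simp only [H.minus_plus, Finset.sum_add_distrib, key, Finset.sum_ite_eq,
      Finset.mem_univ, if_true]
    push_cast
    rw [add_smul ((n : ℂ) + 1) 1, one_smul]

theorem tensorVector_injOn (H : IsFockSystem R p a v₀) (hv₀ : v₀ ≠ 0) {n : ℕ} {Ψ : Tensors m n}
    (h : Ψ ∈ invariantTensors R n) (h0 : tensorVector p v₀ n Ψ = 0) : Ψ = 0 := by
  induction n with
  | zero =>
    rw [tensorVector_zero, smul_eq_zero] at h0
    funext w
    rw [Subsingleton.elim w default]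
    exact h0.resolve_right hv₀
  | succ n ih =>
    refine Tensors.ext_slice fun c => ih (slice_mem_invariantTensors h c) ?_
    have h1 := H.minus_tensorVector h c
    rw [h0, map_zero, eq_comm, smul_eq_zero] at h1
    exact h1.resolve_left (Nat.cast_add_one_ne_zero n)

theorem minus_mem_range (H : IsFockSystem R p a v₀) {n : ℕ} (i : Fin m) {v : V}
    (hv : v ∈ LinearMap.range (tensorVector p v₀ (n + 1))) :
    a i v ∈ LinearMap.range (tensorVector p v₀ n) := by
  have hmono (w : Fin (n + 1) → Fin m) :
      a i (monomialVector p v₀ w) ∈ LinearMap.range (tensorVector p v₀ n) := by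
    clear hv
    induction n generalizing i with
    | zero =>
      rw [← Fin.cons_self_tail w, monomialVector_cons, H.minus_plus]
      refine add_mem (sum_mem fun k _ => sum_mem fun l _ => Submodule.smul_mem _ _ ?_) ?_
      · rw [monomialVector_zero, H.minus_vacuum, map_zero]
        exact zero_mem _
      · split_ifs
        · exact monomialVector_mem_range _
        · exact zero_mem _
    | succ n ih =>
      rw [← Fin.cons_self_tail w, monomialVector_cons, H.minus_plus]
      refine add_mem (sum_mem fun k _ => sum_mem fun l _ => Submodule.smul_mem _ _ ?_) ?_
      · exact plus_mem_range k (ih l _)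
      · split_ifs
        · exact monomialVector_mem_range _
        · exact zero_mem _
  obtain ⟨Ψ, rfl⟩ := hv
  rw [tensorVector_apply, map_sum]
  refine sum_mem fun w _ => ?_
  rw [map_smul]
  exact Submodule.smul_mem _ _ (hmono w)

theorem sum_plus_minus (H : IsFockSystem R p a v₀) {n : ℕ} {v : V}
    (hv : v ∈ LinearMap.range (tensorVector p v₀ n)) : ∑ c, p c (a c v) = (n : ℂ) • v := by
  have hmono (w : Fin n → Fin m) : ∑ c, p c (a c (monomialVector p v₀ w)) =
      (n : ℂ) • monomialVector p v₀ w := by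
    clear hv
    induction n with
    | zero => simp [monomialVector_zero, H.minus_vacuum]
    | succ n ih =>
      rw [← Fin.cons_self_tail w, monomialVector_cons]
      generalize w 0 = j
      specialize ih (Fin.tail w)
      generalize monomialVector p v₀ (Fin.tail w) = u at ih
      -- The p p relation absorbs `R`; with N = ∑ p_c a_c the outcome is N p_j u = p_j N u + p_j u.
      have h : ∑ c, ∑ k, ∑ l, R (c, k) (j, l) • p c (p k (a l u)) = p j (∑ l, p l (a l u)) := by
        rw [map_sum]
        simp only [H.plus_plus j]
        refine (Finset.sum_congr rfl fun c _ => Finset.sum_comm).trans ?_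
        exact Finset.sum_comm
      have h' (c : Fin m) : p c (if c = j then u else 0) = if c = j then p j u else 0 := by
        split_ifs with hc
        · rw [hc]
        · exact map_zero _
      simp only [H.minus_plus, map_add, map_sum, map_smul, Finset.sum_add_distrib, h']
      rw [h, ih, map_smul, Finset.sum_ite_eq' Finset.univ j, if_pos (Finset.mem_univ j)]
      push_cast
      rw [add_smul, one_smul]
  obtain ⟨Ψ, rfl⟩ := hv
  simp only [tensorVector_apply, map_sum, map_smul]
  rw [Finset.sum_comm, Finset.smul_sum]
  refine Finset.sum_congr rfl fun w _ => ?_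
  rw [← Finset.smul_sum, hmono, smul_comm]

theorem exists_invariant_tensorVector_eq (H : IsFockSystem R p a v₀) (hv₀ : v₀ ≠ 0) {n : ℕ} {v : V}
    (hv : v ∈ LinearMap.range (tensorVector p v₀ n)) :
    ∃ Φ ∈ invariantTensors R n, tensorVector p v₀ n Φ = v := by
  induction n generalizing v with
  | zero =>
    obtain ⟨Φ, rfl⟩ := hv
    exact ⟨Φ, mem_invariantTensors_of_lt_two (by omega) _, rfl⟩
  | succ n ih =>
    choose Φ hΦ hΦv using fun c => ih (H.minus_mem_range c hv)
    have hn : (n : ℂ) + 1 ≠ 0 := Nat.cast_add_one_ne_zero n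
    -- The only possible choice: `minus_tensorVector` forces each slice to have state a_c v/(n+1).
    let Ψ : Tensors m (n + 1) := fun w => ((n : ℂ) + 1)⁻¹ • Φ (w 0) (Fin.tail w)
    have hslice (c : Fin m) : Tensors.slice c Ψ = ((n : ℂ) + 1)⁻¹ • Φ c := by
      funext w
      simp [Tensors.slice, Ψ]
    refine ⟨Ψ, ?_, ?_⟩
    · cases n with
      | zero => exact mem_invariantTensors_of_lt_two (by omega) _
      | succ n =>
        refine mem_invariantTensors_succ_succ.2 ⟨fun c k => ?_, fun c => ?_⟩
        · have hmem (i l : Fin m) : Tensors.slice l (Φ i) ∈ invariantTensors R n :=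
            slice_mem_invariantTensors (hΦ i) l
          have hstate (i l : Fin m) : tensorVector p v₀ n (Tensors.slice l (Φ i)) =
              ((n : ℂ) + 1)⁻¹ • a l (a i v) := by
            rw [← hΦv, H.minus_tensorVector (hΦ i), inv_smul_smul₀]
            exact Nat.cast_add_one_ne_zero n
          have hscal (i l : Fin m) : Tensors.slice l (Tensors.slice i Ψ) =
              (((n + 1 : ℕ) : ℂ) + 1)⁻¹ • Tensors.slice l (Φ i) := by
            rw [hslice]
            rfl
          simp only [hscal, smul_comm (R _ _), ← Finset.smul_sum]
          congr 1
          -- The two sides differ by an invariant tensor of rank n, so by injectivity it suffices to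
          -- compare states; there the identity is the a a relation applied to v.
          rw [← sub_eq_zero]
          refine H.tensorVector_injOn hv₀ (sub_mem (sum_mem fun i _ => sum_mem fun l _ =>
            Submodule.smul_mem _ _ (hmem i l)) (hmem c k)) ?_
          simp only [map_sub, map_sum, map_smul, hstate]
          rw [sub_eq_zero, H.minus_minus k c, Finset.sum_comm]
          simp only [Finset.smul_sum, smul_comm (R _ _)]
        · rw [hslice]
          exact Submodule.smul_mem _ _ (hΦ c)
    · rw [tensorVector_succ]
      simp only [hslice, map_smul, hΦv, ← Finset.smul_sum]
      rw [H.sum_plus_minus hv]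
      push_cast
      exact inv_smul_smul₀ hn v

end IsFockSystem

end States

section Fock

variable {m : ℕ}

theorem mixedRel_psi (R : Tensor4 m) : MixedRel R (psiPlus R) (psiMinus R) := by
  intro i j
  have h := RingQuot.mkAlgHom_rel ℂ (Rel.minus_plus (R := R) i j)
  simp only [map_mul, map_add, map_sum, map_smul] at h
  refine h.trans ?_
  congr 1
  split_ifs <;> simp

theorem psiPlus_mul_psiPlus (R : Tensor4 m) (i j : Fin m) :
    psiPlus R i * psiPlus R j = ∑ k, ∑ l, R (k, l) (i, j) • (psiPlus R k * psiPlus R l) := by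
  have h := RingQuot.mkAlgHom_rel ℂ (Rel.plus_plus (R := R) i j)
  simp only [map_mul, map_sum, map_smul] at h
  exact h

theorem psiMinus_mul_psiMinus (R : Tensor4 m) (i j : Fin m) :
    psiMinus R i * psiMinus R j = ∑ k, ∑ l, R (j, i) (l, k) • (psiMinus R k * psiMinus R l) := by
  have h := RingQuot.mkAlgHom_rel ℂ (Rel.minus_minus (R := R) i j)
  simp only [map_mul, map_sum, map_smul] at h
  exact h

theorem psiMinus_smul_vacuum (R : Tensor4 m) (i : Fin m) : psiMinus R i • vacuum R = 0 := by
  rw [vacuum, ← Submodule.Quotient.mk_smul, smul_eq_mul, mul_one, Submodule.Quotient.mk_eq_zero]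
  exact Submodule.subset_span ⟨i, rfl⟩

/-- The action of `X_R` on the Fock module by complex-linear maps. -/
noncomputable def fockAction (R : Tensor4 m) : XAlg R →ₐ[ℂ] Module.End ℂ (Fock R) :=
  Algebra.lsmul ℂ ℂ (Fock R)

theorem fockAction_apply (R : Tensor4 m) (x : XAlg R) (v : Fock R) : fockAction R x v = x • v := rfl

theorem isFockSystem_fockAction (R : Tensor4 m) :
    IsFockSystem R (fun i => fockAction R (psiPlus R i)) (fun i => fockAction R (psiMinus R i))
      (vacuum R) where
  minus_plus i j v := by
    rw [← Module.End.mul_apply, ← map_mul, mixedRel_psi]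
    simp only [map_add, map_sum, map_smul, map_mul, LinearMap.add_apply, LinearMap.sum_apply,
      LinearMap.smul_apply, Module.End.mul_apply]
    split_ifs <;> simp
  plus_plus i j v := by
    rw [← Module.End.mul_apply, ← map_mul, psiPlus_mul_psiPlus]
    simp only [map_sum, map_smul, map_mul, LinearMap.sum_apply,
      LinearMap.smul_apply, Module.End.mul_apply]
  minus_minus i j v := by
    rw [← Module.End.mul_apply, ← map_mul, psiMinus_mul_psiMinus]
    simp only [map_sum, map_smul, map_mul, LinearMap.sum_apply,
      LinearMap.smul_apply, Module.End.mul_apply]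
  minus_vacuum i := psiMinus_smul_vacuum R i

theorem monomialVector_fockAction (R : Tensor4 m) {n : ℕ} (w : Fin n → Fin m) :
    monomialVector (fun i => fockAction R (psiPlus R i)) (vacuum R) w = monomialState R w := by
  rw [monomialState, ← fockAction_apply, map_list_prod, List.map_ofFn]
  rfl

theorem tensorVector_fockAction (R : Tensor4 m) {n : ℕ} (Ψ : Tensors m n) :
    tensorVector (fun i => fockAction R (psiPlus R i)) (vacuum R) n Ψ = tensorState R Ψ := by
  rw [tensorVector_apply, tensorState]
  exact Finset.sum_congr rfl fun w _ => congrArg (Ψ w • ·) (monomialVector_fockAction R w)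

theorem range_tensorVector_fockAction (R : Tensor4 m) (n : ℕ) :
    LinearMap.range (tensorVector (fun i => fockAction R (psiPlus R i)) (vacuum R) n) =
      nParticle R n := by
  rw [tensorVector, Fintype.range_linearCombination, nParticle]
  exact congrArg (fun f => Submodule.span ℂ (Set.range f))
    (funext fun w => monomialVector_fockAction R w)

end Fock

end Paraparticle

theorem theorem3 {m : ℕ} (R : Paraparticle.Tensor4 m) (hR : Paraparticle.IsRMatrix R) (n : ℕ)
    {ι : Type*} (Ψ : Module.Basis ι ℂ (Paraparticle.invariantTensors R n)) :
    LinearIndependent ℂ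
        (fun α => Paraparticle.tensorState R (Ψ α : Paraparticle.Tensors m n)) ∧
      Submodule.span ℂ
          (Set.range fun α => Paraparticle.tensorState R (Ψ α : Paraparticle.Tensors m n)) =
        Paraparticle.nParticle R n := by
  have H := Paraparticle.isFockSystem_fockAction R
  have hv := Paraparticle.vacuum_ne_zero hR
  simp only [← Paraparticle.tensorVector_fockAction, ← Paraparticle.range_tensorVector_fockAction]
  set T := Paraparticle.tensorVector
    (fun i => Paraparticle.fockAction R (Paraparticle.psiPlus R i)) (Paraparticle.vacuum R) n
  -- `T'` is injective with the same range as `T`, so it carries any basis to a basis of the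
  -- n-particle space.
  let T' := T ∘ₗ (Paraparticle.invariantTensors R n).subtype
  constructor
  · exact Ψ.linearIndependent.map' T' (LinearMap.ker_eq_bot'.2 fun Φ hΦ =>
      Subtype.ext (H.tensorVector_injOn hv Φ.2 hΦ))
  · have h : Submodule.span ℂ (Set.range (T' ∘ Ψ)) = LinearMap.range T' := by
      rw [Set.range_comp, Submodule.span_image, Ψ.span_eq, Submodule.map_top]
    refine h.trans (le_antisymm (LinearMap.range_comp_le_range _ _) fun v hmem => ?_)
    obtain ⟨Φ, hΦ, rfl⟩ := H.exists_invariant_tensorVector_eq hv hmem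
    exact ⟨⟨Φ, hΦ⟩, rfl⟩
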